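/- For a compact set $C\subset\mathbb R^3$ let $$\operatorname{cap}(C)=\inf\Big\{\tfrac1{4\pi}\int_{\mathbb R^3}|\nabla\varphi|^2\,dx \;:\; \varphi\in C_c^\infty(\mathbb R^3),\ \varphi\ge 1\text{ on }C\Big\}$$ be its Newtonian capacity, and say that a closed set $E\subset\mathbb R^3$ has Newtonian capacity zero if $\operatorname{cap}(C)=0$ for every compact $C\subset E$. Regard $\mathbb R^3$ as the complement of the north pole in the unit sphere $S^3\subset\mathbb R^4$ by means of the inverse stereographic projection $$\sigma(x)=\frac{\big(4x,\ |x|^2-4\big)}{|x|^2+4},\qquad x\in\mathbb R^3,$$ and put $$\operatorname{dist}_{S^3}(x,E)=\inf_{y\in E}\ \arccos\,\langle\sigma(x),\sigma(y)\rangle,$$ the distance from $x$ to $E$ in the standard (round, geodesic) metric of $S^3$, with $\operatorname{dist}_{S^3}(x,\emptyset)=\infty$ and $1/\infty=0$. **Proposition.** Let $E$ be a closed subset of $\mathbb R^3$ of Newtonian capacity zero and let $\Psi$ be a nonnegative harmonic function on $\mathbb R^3\setminus E$. Then there is a constant $K\ge 0$ such that $$\Psi(x)\le K+\frac{K}{\operatorname{dist}_{S^3}(x,E)}\qquad\text{for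 all }x\in\mathbb R^3\setminus E.$$ -/

import Mathlib

open scoped NNReal ENNReal ContDiff

noncomputable section

/-- The Newtonian capacity of a compact set `C ⊆ ℝ³`, defined variationally: the infimum of the
normalized Dirichlet energy `(4π)⁻¹ ∫ |∇φ|²` over all smooth compactly supported `φ : ℝ³ → ℝ` with
`φ ≥ 1` on `C`. -/
def newtonianCapacityCompact (C : Set (EuclideanSpace ℝ (Fin 3))) : ℝ≥0∞ :=
  ⨅ (φ : EuclideanSpace ℝ (Fin 3) → ℝ) (_ : ContDiff ℝ ∞ φ) (_ : HasCompactSupport φ)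
    (_ : ∀ x ∈ C, 1 ≤ φ x),
    ENNReal.ofReal (4 * Real.pi)⁻¹ * ∫⁻ x, ‖gradient φ x‖ₑ ^ 2

/-- The (inner) Newtonian capacity of a set `E ⊆ ℝ³`: the supremum of the capacities of the compact
subsets of `E`. -/
def newtonianCapacity (E : Set (EuclideanSpace ℝ (Fin 3))) : ℝ≥0∞ :=
  ⨆ (C : Set (EuclideanSpace ℝ (Fin 3))) (_ : IsCompact C) (_ : C ⊆ E),
    newtonianCapacityCompact C

/-- The north pole of the unit sphere `S³ ⊆ ℝ⁴`. -/
def northPole : Metric.sphere (0 : EuclideanSpace ℝ (Fin 4)) 1 :=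
  ⟨EuclideanSpace.single 3 1, by simp⟩

instance factFinrankEuclideanFour : Fact (Module.finrank ℝ (EuclideanSpace ℝ (Fin 4)) = 3 + 1) :=
  ⟨by simp⟩

/-- Inverse stereographic projection from the north pole, `ℝ³ → S³ ⊆ ℝ⁴`; its image is the
complement of the north pole. -/
def toSphere (x : EuclideanSpace ℝ (Fin 3)) : EuclideanSpace ℝ (Fin 4) :=
  ((stereographic' 3 northPole).symm x : Metric.sphere (0 : EuclideanSpace ℝ (Fin 4)) 1)

/-- The geodesic distance of the round unit sphere `S³` between two points of `ℝ³`: the angle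
between the corresponding unit vectors of `ℝ⁴`. -/
def sphereDist (x y : EuclideanSpace ℝ (Fin 3)) : ℝ :=
  InnerProductGeometry.angle (toSphere x) (toSphere y)

/-- The distance, in the standard metric of `S³`, from a point `x` of `ℝ³` to a set `E ⊆ ℝ³`
(it is `∞` exactly when `E` is empty). -/
def sphereInfDist (x : EuclideanSpace ℝ (Fin 3)) (E : Set (EuclideanSpace ℝ (Fin 3))) : ℝ≥0∞ :=
  ⨅ y ∈ E, ENNReal.ofReal (sphereDist x y)

end

open MeasureTheory Set Filter Topology

/-- The cube of the positive part, as a convex function of class `C²`. -/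
noncomputable def posCube (t : ℝ) : ℝ := max t 0 ^ 3

lemma hasDerivAt_max_zero_pow (n : ℕ) (t : ℝ) :
    HasDerivAt (fun t : ℝ => max t 0 ^ (n + 2)) ((n + 2) * max t 0 ^ (n + 1)) t := by
  rcases lt_trichotomy t 0 with h | rfl | h
  · have : (fun t : ℝ => max t 0 ^ (n + 2)) =ᶠ[𝓝 t] fun _ => 0 := by
      filter_upwards [Iio_mem_nhds h] with s hs
      simp [max_eq_right (le_of_lt (mem_Iio.1 hs))]
    rw [max_eq_right h.le]
    simpa using (hasDerivAt_const t (0 : ℝ)).congr_of_eventuallyEq this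
  · have : (fun t : ℝ => max t 0 ^ (n + 2)) =O[𝓝 0] fun t : ℝ => t ^ (n + 2) := by
      refine Asymptotics.IsBigO.of_bound 1 (Eventually.of_forall fun t => ?_)
      rw [norm_pow, norm_pow, one_mul]
      refine pow_le_pow_left₀ (norm_nonneg _) ?_ _
      rw [Real.norm_eq_abs, Real.norm_eq_abs, abs_of_nonneg (le_max_right _ _)]
      exact max_le (le_abs_self t) (abs_nonneg t)
    have h2 := this.trans_isLittleO (Asymptotics.isLittleO_pow_id (𝕜 := ℝ) (n := n + 2) (by omega))
    rw [hasDerivAt_iff_isLittleO]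
    simpa using h2
  · have : (fun t : ℝ => max t 0 ^ (n + 2)) =ᶠ[𝓝 t] fun t => t ^ (n + 2) := by
      filter_upwards [Ioi_mem_nhds h] with s hs
      simp [max_eq_left (le_of_lt (mem_Ioi.1 hs))]
    rw [max_eq_left h.le]
    have h2 := (hasDerivAt_pow (n + 2) t).congr_of_eventuallyEq this
    simpa using h2

lemma hasDerivAt_posCube (t : ℝ) : HasDerivAt posCube (3 * max t 0 ^ 2) t := by
  have := hasDerivAt_max_zero_pow 1 t
  norm_num at this
  exact this

lemma deriv_posCube : deriv posCube = fun t => 3 * max t 0 ^ 2 :=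
  funext fun t => (hasDerivAt_posCube t).deriv

lemma hasDerivAt_deriv_posCube (t : ℝ) : HasDerivAt (deriv posCube) (6 * max t 0) t := by
  rw [deriv_posCube]
  have := (hasDerivAt_max_zero_pow 0 t).const_mul 3
  norm_num at this
  rwa [← mul_assoc, show (3 : ℝ) * 2 = 6 by norm_num] at this

lemma contDiff_posCube : ContDiff ℝ 2 posCube := by
  have h1 : ContDiff ℝ 1 (deriv posCube) := by
    rw [contDiff_one_iff_deriv]
    refine ⟨fun t => (hasDerivAt_deriv_posCube t).differentiableAt, ?_⟩
    have : deriv (deriv posCube) = fun t => 6 * max t 0 :=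
      funext fun t => (hasDerivAt_deriv_posCube t).deriv
    rw [this]
    fun_prop
  have : (2 : WithTop ℕ∞) = 1 + 1 := by norm_num
  rw [this, contDiff_succ_iff_deriv]
  refine ⟨fun t => (hasDerivAt_posCube t).differentiableAt, by simp, h1⟩

lemma posCube_of_nonpos {t : ℝ} (h : t ≤ 0) : posCube t = 0 := by
  simp [posCube, max_eq_right h]

lemma posCube_nonneg (t : ℝ) : 0 ≤ posCube t := pow_nonneg (le_max_right _ _) _

lemma posCube_le {t M : ℝ} (hM : 0 ≤ M) (h : t ≤ M) : posCube t ≤ M ^ 3 :=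
  pow_le_pow_left₀ (le_max_right _ _) (max_le h hM) _

lemma nonpos_of_posCube_eq_zero {t : ℝ} (h : posCube t = 0) : t ≤ 0 := by
  have := pow_eq_zero_iff (n := 3) (by norm_num) |>.1 h
  exact max_eq_right_iff.1 this

/-- The partial derivative of `f` in the direction of the `i`-th coordinate. -/
noncomputable def partialDeriv (i : Fin 3) (f : EuclideanSpace ℝ (Fin 3) → ℝ)
    (x : EuclideanSpace ℝ (Fin 3)) : ℝ :=
  fderiv ℝ f x (EuclideanSpace.single i 1)

lemma norm_fderiv_sq (f : EuclideanSpace ℝ (Fin 3) → ℝ) (x : EuclideanSpace ℝ (Fin 3)) :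
    ‖fderiv ℝ f x‖ ^ 2 = ∑ i, partialDeriv i f x ^ 2 := by
  set y := (InnerProductSpace.toDual ℝ (EuclideanSpace ℝ (Fin 3))).symm (fderiv ℝ f x) with hy
  have h1 : ‖fderiv ℝ f x‖ = ‖y‖ := by simp [hy]
  have h2 : ∀ i, partialDeriv i f x = y i := by
    intro i
    have : partialDeriv i f x = inner ℝ y (EuclideanSpace.single i 1) := by
      rw [hy, InnerProductSpace.toDual_symm_apply]; rfl
    rw [this]
    simp [EuclideanSpace.inner_single_right]
  rw [h1, EuclideanSpace.norm_sq_eq]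
  simp [h2]

lemma partialDeriv_congr {i : Fin 3} {f g : EuclideanSpace ℝ (Fin 3) → ℝ}
    {x : EuclideanSpace ℝ (Fin 3)} (h : f =ᶠ[𝓝 x] g) : partialDeriv i f x = partialDeriv i g x := by
  rw [partialDeriv, partialDeriv, h.fderiv_eq]

lemma ContDiffAt.partialDeriv_one {f : EuclideanSpace ℝ (Fin 3) → ℝ}
    {x : EuclideanSpace ℝ (Fin 3)} (h : ContDiffAt ℝ 2 f x) (i : Fin 3) :
    ContDiffAt ℝ 1 (partialDeriv i f) x :=
  (h.fderiv_right (m := 1) (by norm_num)).clm_apply contDiffAt_const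

lemma InnerProductSpace.HarmonicAt.sum_partialDeriv {f : EuclideanSpace ℝ (Fin 3) → ℝ}
    {x : EuclideanSpace ℝ (Fin 3)} (h : InnerProductSpace.HarmonicAt f x) :
    ∑ i, partialDeriv i (partialDeriv i f) x = 0 := by
  have h0 := h.2.self_of_nhds
  rw [InnerProductSpace.laplacian_eq_iteratedFDeriv_orthonormalBasis f
    (EuclideanSpace.basisFun (Fin 3) ℝ)] at h0
  rw [← show _ = (0 : ℝ) from h0]
  refine Finset.sum_congr rfl fun i _ => ?_
  rw [iteratedFDeriv_two_apply]
  have hd : DifferentiableAt ℝ (fderiv ℝ f) x :=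
    (h.1.fderiv_right (m := 1) (by norm_num)).differentiableAt (by norm_num)
  simp only [EuclideanSpace.basisFun_apply, Matrix.cons_val_zero, Matrix.cons_val_one]
  change fderiv ℝ (fun y => fderiv ℝ f y (EuclideanSpace.single i 1)) x _ = _
  rw [fderiv_clm_apply hd (differentiableAt_const _)]
  simp

lemma partialDeriv_mul {i : Fin 3} {f g : EuclideanSpace ℝ (Fin 3) → ℝ}
    {x : EuclideanSpace ℝ (Fin 3)} (hf : DifferentiableAt ℝ f x) (hg : DifferentiableAt ℝ g x) :
    partialDeriv i (fun y => f y * g y) x = f x * partialDeriv i g x + partialDeriv i f x * g x := by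
  simp only [partialDeriv]
  rw [fderiv_fun_mul hf hg]
  simp [mul_comm]

lemma partialDeriv_sub {i : Fin 3} {f g : EuclideanSpace ℝ (Fin 3) → ℝ}
    {x : EuclideanSpace ℝ (Fin 3)} (hf : DifferentiableAt ℝ f x) (hg : DifferentiableAt ℝ g x) :
    partialDeriv i (fun y => f y - g y) x = partialDeriv i f x - partialDeriv i g x := by
  simp only [partialDeriv]
  rw [fderiv_fun_sub hf hg]
  simp

lemma partialDeriv_const_mul {i : Fin 3} {f : EuclideanSpace ℝ (Fin 3) → ℝ} (c : ℝ)
    {x : EuclideanSpace ℝ (Fin 3)} (hf : DifferentiableAt ℝ f x) :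
    partialDeriv i (fun y => c * f y) x = c * partialDeriv i f x := by
  simp only [partialDeriv]
  rw [fderiv_const_mul hf]
  simp

lemma partialDeriv_const (i : Fin 3) (c : ℝ) (x : EuclideanSpace ℝ (Fin 3)) :
    partialDeriv i (fun _ => c) x = 0 := by
  simp [partialDeriv]

lemma partialDeriv_comp {i : Fin 3} {F : ℝ → ℝ} {f : EuclideanSpace ℝ (Fin 3) → ℝ}
    {x : EuclideanSpace ℝ (Fin 3)} (hF : DifferentiableAt ℝ F (f x)) (hf : DifferentiableAt ℝ f x) :
    partialDeriv i (fun y => F (f y)) x = deriv F (f x) * partialDeriv i f x := by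
  simp only [partialDeriv]
  have := (hF.hasDerivAt.comp_hasFDerivAt x hf.hasFDerivAt).fderiv
  change fderiv ℝ (F ∘ f) x _ = _
  rw [this]
  simp

lemma sum_partialDeriv_comp {F : ℝ → ℝ} (hF : ContDiff ℝ 2 F) {f : EuclideanSpace ℝ (Fin 3) → ℝ}
    {x : EuclideanSpace ℝ (Fin 3)} (hf : ContDiffAt ℝ 2 f x) :
    ∑ i, partialDeriv i (partialDeriv i (fun y => F (f y))) x =
      deriv (deriv F) (f x) * ∑ i, partialDeriv i f x ^ 2 +
        deriv F (f x) * ∑ i, partialDeriv i (partialDeriv i f) x := by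
  have hF1 : ContDiff ℝ 1 (deriv F) :=
    ((contDiff_succ_iff_deriv (n := 1)).1 (by simpa [one_add_one_eq_two] using hF)).2.2
  rw [Finset.mul_sum, Finset.mul_sum, ← Finset.sum_add_distrib]
  refine Finset.sum_congr rfl fun i _ => ?_
  have hev : partialDeriv i (fun y => F (f y)) =ᶠ[𝓝 x]
      fun y => deriv F (f y) * partialDeriv i f y := by
    filter_upwards [hf.eventually (by simp)] with y hy
    exact partialDeriv_comp (hF.differentiable (by norm_num) _)
      (hy.differentiableAt (by norm_num))
  have hd := hf.differentiableAt (by norm_num)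
  have hd1 : DifferentiableAt ℝ (deriv F) (f x) := hF1.differentiable (by norm_num) _
  rw [partialDeriv_congr hev, partialDeriv_mul (f := fun y => deriv F (f y)) (hd1.comp x hd)
    ((hf.partialDeriv_one i).differentiableAt (by norm_num)), partialDeriv_comp hd1 hd]
  ring

lemma norm_sq_sub_pos {x a : EuclideanSpace ℝ (Fin 3)} (h : x ≠ a) : 0 < ‖x - a‖ ^ 2 := by
  have := norm_pos_iff.2 (sub_ne_zero.2 h)
  positivity

lemma contDiffAt_norm_sub_inv {x a : EuclideanSpace ℝ (Fin 3)} (h : x ≠ a) :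
    ContDiffAt ℝ 2 (fun y : EuclideanSpace ℝ (Fin 3) => ‖y - a‖⁻¹) x :=
  ((contDiffAt_id.sub contDiffAt_const).norm ℝ (sub_ne_zero.2 h)).inv
    (norm_ne_zero_iff.2 (sub_ne_zero.2 h))

lemma partialDeriv_norm_sub_rpow (i : Fin 3) (p : ℝ) {x a : EuclideanSpace ℝ (Fin 3)}
    (h : x ≠ a) :
    partialDeriv i (fun y => (‖y - a‖ ^ 2) ^ p) x =
      2 * p * (‖x - a‖ ^ 2) ^ (p - 1) * (x i - a i) := by
  have h1 : HasFDerivAt (fun y : EuclideanSpace ℝ (Fin 3) => ‖y - a‖ ^ 2)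
      (2 • (innerSL ℝ (x - a))) x := by
    have := (hasFDerivAt_id x).sub_const a |>.norm_sq
    simpa using this
  have h2 := h1.rpow_const (p := p) (Or.inl (norm_sq_sub_pos h).ne')
  rw [partialDeriv, h2.fderiv]
  simp [EuclideanSpace.inner_single_right]
  ring

lemma partialDeriv_coord_sub (i : Fin 3) (c : ℝ) (x : EuclideanSpace ℝ (Fin 3)) :
    partialDeriv i (fun y => y i - c) x = 1 := by
  have h : HasFDerivAt (fun y : EuclideanSpace ℝ (Fin 3) => y i - c)
      (EuclideanSpace.proj i : EuclideanSpace ℝ (Fin 3) →L[ℝ] ℝ) x :=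
    (EuclideanSpace.proj i : EuclideanSpace ℝ (Fin 3) →L[ℝ] ℝ).hasFDerivAt.sub_const c
  rw [partialDeriv, h.fderiv]
  simp

lemma sum_partialDeriv_norm_sub_inv {x a : EuclideanSpace ℝ (Fin 3)} (h : x ≠ a) :
    ∑ i, partialDeriv i (partialDeriv i (fun y => ‖y - a‖⁻¹)) x = 0 := by
  have hq := norm_sq_sub_pos h
  have hfun : (fun y : EuclideanSpace ℝ (Fin 3) => ‖y - a‖⁻¹) =
      fun y => (‖y - a‖ ^ 2) ^ (-(1 / 2) : ℝ) := by
    funext y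
    rw [Real.rpow_neg (by positivity), ← Real.sqrt_eq_rpow, Real.sqrt_sq (norm_nonneg _)]
  have key : ∀ i, partialDeriv i (partialDeriv i (fun y => ‖y - a‖⁻¹)) x =
      3 * (‖x - a‖ ^ 2) ^ (-(5 / 2) : ℝ) * (x i - a i) ^ 2 - (‖x - a‖ ^ 2) ^ (-(3 / 2) : ℝ) := by
    intro i
    have hev : partialDeriv i (fun y => ‖y - a‖⁻¹) =ᶠ[𝓝 x]
        fun y => (-1 * (‖y - a‖ ^ 2) ^ (-(3 / 2) : ℝ)) * (y i - a i) := by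
      filter_upwards [isOpen_ne.mem_nhds h] with y hy
      rw [hfun, partialDeriv_norm_sub_rpow i _ hy]
      norm_num
    have hd : DifferentiableAt ℝ
        (fun y : EuclideanSpace ℝ (Fin 3) => (‖y - a‖ ^ 2) ^ (-(3 / 2) : ℝ)) x := by
      have h1 : DifferentiableAt ℝ (fun y : EuclideanSpace ℝ (Fin 3) => ‖y - a‖ ^ 2) x :=
        (differentiableAt_id.sub_const a).norm_sq ℝ
      exact h1.rpow_const (Or.inl hq.ne')
    have hd2 : DifferentiableAt ℝ (fun y : EuclideanSpace ℝ (Fin 3) => y i - a i) x := by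
      fun_prop
    rw [partialDeriv_congr hev, partialDeriv_mul (hd.const_mul _) hd2, partialDeriv_const_mul _ hd,
      partialDeriv_norm_sub_rpow i _ h, partialDeriv_coord_sub]
    norm_num
    ring
  have hn : ‖x - a‖ ^ 2 = ∑ i, (x i - a i) ^ 2 := by
    rw [EuclideanSpace.norm_sq_eq]; simp
  have hp : (‖x - a‖ ^ 2) ^ (-(3 / 2) : ℝ) = (‖x - a‖ ^ 2) ^ (-(5 / 2) : ℝ) * ‖x - a‖ ^ 2 := by
    rw [← Real.rpow_add_one hq.ne']; norm_num
  simp only [key]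
  rw [Finset.sum_sub_distrib, ← Finset.mul_sum, ← hn, hp]
  simp
  ring

lemma integral_partialDeriv_eq_zero (i : Fin 3) {g : EuclideanSpace ℝ (Fin 3) → ℝ}
    (hg : ContDiff ℝ 1 g) (hc : HasCompactSupport g) : ∫ x, partialDeriv i g x = 0 := by
  have hcont : Continuous (partialDeriv i g) :=
    (hg.continuous_fderiv (by norm_num)).clm_apply continuous_const
  have hcs : HasCompactSupport (partialDeriv i g) :=
    hc.fderiv_apply ℝ (EuclideanSpace.single i 1)
  have := integral_mul_fderiv_eq_neg_fderiv_mul_of_integrable (μ := volume) (f := fun _ => (1 : ℝ))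
    (g := g) (v := EuclideanSpace.single i 1) (by simp)
    (by simp only [one_mul]; exact hcont.integrable_of_hasCompactSupport hcs)
    (by simp only [one_mul]; exact hg.continuous.integrable_of_hasCompactSupport hc)
    (fun _ _ => differentiableAt_const _) (fun x _ => hg.differentiable (by norm_num) x)
  simpa [partialDeriv] using this

lemma contDiff_mul_of_tsupport {n : ℕ∞} {η w : EuclideanSpace ℝ (Fin 3) → ℝ} (hη : ContDiff ℝ n η)
    (hw : ∀ x ∈ tsupport η, ContDiffAt ℝ n w x) : ContDiff ℝ n (fun x => η x * w x) := by
  rw [contDiff_iff_contDiffAt]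
  intro x
  by_cases hx : x ∈ tsupport η
  · exact hη.contDiffAt.mul (hw x hx)
  · have : (fun x => η x * w x) =ᶠ[𝓝 x] fun _ => 0 := by
      filter_upwards [notMem_tsupport_iff_eventuallyEq.1 hx] with y hy
      simp [hy]
    exact contDiffAt_const.congr_of_eventuallyEq this

/-- A Caccioppoli type inequality: if `w Δw ≥ 0` on the support of the cutoff function `η`, then the
energy of `η w` is at most `∫ w² |∇η|²`. -/
lemma integral_norm_fderiv_mul_sq_le {η w : EuclideanSpace ℝ (Fin 3) → ℝ} (hη : ContDiff ℝ 2 η)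
    (hw : ∀ x ∈ tsupport η, ContDiffAt ℝ 2 w x) (hc : HasCompactSupport w)
    (hsub : ∀ x ∈ tsupport η, 0 ≤ w x * ∑ i, partialDeriv i (partialDeriv i w) x) :
    Integrable (fun x => ‖fderiv ℝ (fun x => η x * w x) x‖ ^ 2) ∧
      Integrable (fun x => w x ^ 2 * ‖fderiv ℝ η x‖ ^ 2) ∧
      ∫ x, ‖fderiv ℝ (fun x => η x * w x) x‖ ^ 2 ≤ ∫ x, w x ^ 2 * ‖fderiv ℝ η x‖ ^ 2 := by
  set f : EuclideanSpace ℝ (Fin 3) → ℝ := fun x => η x * w x with hf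
  have hη1 : ContDiff ℝ 1 η := hη.of_le (by norm_num)
  have hw1 : ∀ x ∈ tsupport η, ContDiffAt ℝ 1 w x := fun x hx => (hw x hx).of_le (by norm_num)
  have hfC : ContDiff ℝ 1 f := contDiff_mul_of_tsupport (n := 1) hη1 hw1
  have hfc : HasCompactSupport f := hc.mul_left
  have hfi : Integrable (fun x => ‖fderiv ℝ f x‖ ^ 2) := by
    refine Continuous.integrable_of_hasCompactSupport
      ((hfC.continuous_fderiv (by norm_num)).norm.pow 2) ?_
    exact (hfc.fderiv ℝ).comp_left (g := fun T => ‖T‖ ^ 2) (by simp)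
  have hts : ∀ i, tsupport (partialDeriv i η) ⊆ tsupport η := fun i =>
    tsupport_fderiv_apply_subset ℝ (EuclideanSpace.single i 1)
  have hηi : ∀ i, ContDiff ℝ 1 (partialDeriv i η) := fun i =>
    (hη.fderiv_right (m := 1) (by norm_num)).clm_apply contDiff_const
  have hwi : ∀ i, Integrable (fun x => (partialDeriv i η x * w x) ^ 2) := by
    intro i
    refine Continuous.integrable_of_hasCompactSupport
      ((contDiff_mul_of_tsupport (n := 1) (hηi i) fun x hx => hw1 x (hts i hx)).continuous.pow 2) ?_
    exact (hc.mul_left (f := partialDeriv i η)).comp_left (g := fun t : ℝ => t ^ 2) (by simp)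
  have hwsum : (fun x => w x ^ 2 * ‖fderiv ℝ η x‖ ^ 2) =
      fun x => ∑ i, (partialDeriv i η x * w x) ^ 2 := by
    funext x
    rw [norm_fderiv_sq, Finset.mul_sum]
    exact Finset.sum_congr rfl fun i _ => by ring
  have hint : Integrable (fun x => w x ^ 2 * ‖fderiv ℝ η x‖ ^ 2) := by
    rw [hwsum]
    exact integrable_finsetSum _ fun i _ => hwi i
  refine ⟨hfi, hint, ?_⟩
  set g : Fin 3 → EuclideanSpace ℝ (Fin 3) → ℝ := fun i x => η x * (f x * partialDeriv i w x)
    with hg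
  have hgC : ∀ i, ContDiff ℝ 1 (g i) := fun i =>
    contDiff_mul_of_tsupport (n := 1) hη1 fun x hx =>
      hfC.contDiffAt.mul ((hw x hx).partialDeriv_one i)
  have hgc : ∀ i, HasCompactSupport (g i) := fun i => (hfc.mul_right).mul_left
  have hgi : ∀ i, Integrable (partialDeriv i (g i)) := fun i =>
    (((hgC i).continuous_fderiv (by norm_num)).clm_apply
      continuous_const).integrable_of_hasCompactSupport
        ((hgc i).fderiv_apply ℝ (EuclideanSpace.single i 1))
  have hpt : ∀ x, ‖fderiv ℝ f x‖ ^ 2 - w x ^ 2 * ‖fderiv ℝ η x‖ ^ 2 ≤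
      ∑ i, partialDeriv i (g i) x := by
    intro x
    by_cases hx : x ∈ tsupport η
    · have hηd : DifferentiableAt ℝ η x := hη.differentiable (by norm_num) x
      have hwd : DifferentiableAt ℝ w x := (hw x hx).differentiableAt (by norm_num)
      have hfd : DifferentiableAt ℝ f x := hfC.differentiable (by norm_num) x
      have hwid : ∀ i, DifferentiableAt ℝ (partialDeriv i w) x := fun i =>
        ((hw x hx).partialDeriv_one i).differentiableAt (by norm_num)
      have h1 : ∀ i, partialDeriv i f x = η x * partialDeriv i w x + partialDeriv i η x * w x :=
        fun i => partialDeriv_mul hηd hwd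
      have h2 : ∀ i, partialDeriv i (g i) x =
          partialDeriv i f x ^ 2 - w x ^ 2 * partialDeriv i η x ^ 2 +
            η x ^ 2 * (w x * partialDeriv i (partialDeriv i w) x) := by
        intro i
        rw [hg, partialDeriv_mul (g := fun x => f x * partialDeriv i w x) hηd (hfd.mul (hwid i)),
          partialDeriv_mul hfd (hwid i), h1]
        simp only [hf]
        ring
      simp only [h2]
      rw [Finset.sum_add_distrib, Finset.sum_sub_distrib, ← norm_fderiv_sq, ← Finset.mul_sum,
        ← norm_fderiv_sq, ← Finset.mul_sum, ← Finset.mul_sum]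
      have := mul_nonneg (sq_nonneg (η x)) (hsub x hx)
      linarith
    · have h0 := notMem_tsupport_iff_eventuallyEq.1 hx
      have h1 : f =ᶠ[𝓝 x] fun _ => 0 := by
        filter_upwards [h0] with y hy
        simp [hf, hy]
      have h2 : ∀ i, g i =ᶠ[𝓝 x] fun _ => 0 := by
        intro i
        filter_upwards [h0] with y hy
        simp [hg, hy]
      have h3 : ∀ i, partialDeriv i (g i) x = 0 := fun i => by
        rw [partialDeriv_congr (h2 i), partialDeriv_const]
      simp only [h3, h1.fderiv_eq]
      simp
      positivity
  have hmono := integral_mono (hfi.sub hint) (integrable_finsetSum _ fun i _ => hgi i) hpt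
  rw [integral_sub' hfi hint, integral_finsetSum _ fun i _ => hgi i] at hmono
  simp only [integral_partialDeriv_eq_zero _ (hgC _) (hgc _)] at hmono
  simpa using hmono

/-- A smooth cutoff profile: `1` near nonpositive arguments, `0` for arguments at least `1 / 2`. -/
noncomputable def cutoffProfile (t : ℝ) : ℝ := 1 - Real.smoothTransition (2 * t)

lemma contDiff_cutoffProfile : ContDiff ℝ ∞ cutoffProfile :=
  contDiff_const.sub (Real.smoothTransition.contDiff.comp (contDiff_const.mul contDiff_id))

lemma cutoffProfile_zero : cutoffProfile 0 = 1 := by simp [cutoffProfile]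

lemma cutoffProfile_of_half_le {t : ℝ} (h : 1 / 2 ≤ t) : cutoffProfile t = 0 := by
  simp [cutoffProfile, Real.smoothTransition.one_of_one_le (show 1 ≤ 2 * t by linarith)]

lemma exists_deriv_cutoffProfile_le : ∃ L : ℝ, 0 ≤ L ∧ ∀ t, ‖deriv cutoffProfile t‖ ≤ L := by
  have hcont : Continuous (deriv cutoffProfile) := contDiff_cutoffProfile.continuous_deriv (by simp)
  have hsupp : HasCompactSupport (deriv cutoffProfile) := by
    refine HasCompactSupport.intro (isCompact_Icc (a := (0 : ℝ)) (b := 1 / 2)) fun t ht => ?_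
    rw [mem_Icc, not_and_or, not_le, not_le] at ht
    rcases ht with ht | ht
    · have : cutoffProfile =ᶠ[𝓝 t] fun _ => 1 := by
        filter_upwards [Iio_mem_nhds ht] with s hs
        simp [cutoffProfile,
          Real.smoothTransition.zero_of_nonpos (show 2 * s ≤ 0 by linarith [mem_Iio.1 hs])]
      rw [this.deriv_eq, deriv_const]
    · have : cutoffProfile =ᶠ[𝓝 t] fun _ => 0 := by
        filter_upwards [Ioi_mem_nhds ht] with s hs
        exact cutoffProfile_of_half_le (le_of_lt (mem_Ioi.1 hs))
      rw [this.deriv_eq, deriv_const]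
  obtain ⟨L, hL⟩ := hsupp.exists_bound_of_continuous hcont
  exact ⟨L, (norm_nonneg _).trans (hL 0), hL⟩

lemma abs_one_sub_cutoffProfile_le {L : ℝ} (hL : ∀ t, ‖deriv cutoffProfile t‖ ≤ L) (t : ℝ) :
    |1 - cutoffProfile t| ≤ L * |t| := by
  have := Convex.norm_image_sub_le_of_norm_deriv_le (f := cutoffProfile) (s := univ) (x := t)
    (y := 0) (C := L) (fun x _ => contDiff_cutoffProfile.differentiable (by simp) x)
    (fun x _ => hL x) convex_univ (mem_univ _) (mem_univ _)
  simpa [cutoffProfile_zero] using this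

lemma exists_energy_lt {E C : Set (EuclideanSpace ℝ (Fin 3))} (hcap : newtonianCapacity E = 0)
    (hC : IsCompact C) (hCE : C ⊆ E) {ε : ℝ≥0∞} (hε : ε ≠ 0) :
    ∃ φ : EuclideanSpace ℝ (Fin 3) → ℝ, ContDiff ℝ ∞ φ ∧ HasCompactSupport φ ∧
      (∀ x ∈ C, 1 ≤ φ x) ∧ ∫⁻ x, ‖fderiv ℝ φ x‖ₑ ^ 2 < ε := by
  have hpi : (0 : ℝ) < (4 * Real.pi)⁻¹ := by positivity
  have h0 : newtonianCapacityCompact C = 0 := by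
    refine le_antisymm ?_ zero_le
    rw [← hcap]
    exact le_iSup₂_of_le C hC (le_iSup_of_le hCE le_rfl)
  have hlt : newtonianCapacityCompact C < ENNReal.ofReal (4 * Real.pi)⁻¹ * ε := by
    rw [h0]
    exact ENNReal.mul_pos (ENNReal.ofReal_pos.2 hpi).ne' hε
  simp only [newtonianCapacityCompact, iInf_lt_iff] at hlt
  obtain ⟨φ, h1, h2, h3, h4⟩ := hlt
  refine ⟨φ, h1, h2, h3, ?_⟩
  have h5 : ∫⁻ x, ‖fderiv ℝ φ x‖ₑ ^ 2 = ∫⁻ x, ‖gradient φ x‖ₑ ^ 2 := by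
    refine lintegral_congr fun x => ?_
    rw [gradient, ← ofReal_norm, ← ofReal_norm, LinearIsometryEquiv.norm_map]
  rw [h5]
  exact lt_of_mul_lt_mul_left' h4

lemma eLpNorm_six_le_eLpNorm_fderiv_two : ∃ S : ℝ≥0, ∀ u : EuclideanSpace ℝ (Fin 3) → ℝ,
    ContDiff ℝ 1 u → HasCompactSupport u →
      eLpNorm u 6 volume ≤ S * eLpNorm (fderiv ℝ u) 2 volume := by
  refine ⟨_, fun u hu hc => eLpNorm_le_eLpNorm_fderiv_of_eq_inner volume (p := 2) (p' := 6) hu hc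
    (by norm_num) (by simp) ?_⟩
  simp
  norm_num

lemma eLpNorm_two_le_of_lintegral_le {V W : Type*} [NormedAddCommGroup V] [NormedAddCommGroup W]
    {f : EuclideanSpace ℝ (Fin 3) → V} {g : EuclideanSpace ℝ (Fin 3) → W} {c : ℝ≥0∞}
    (h : ∫⁻ x, ‖f x‖ₑ ^ 2 ≤ c ^ 2 * ∫⁻ x, ‖g x‖ₑ ^ 2) :
    eLpNorm f 2 volume ≤ c * eLpNorm g 2 volume := by
  have key : ∀ {V : Type _} [NormedAddCommGroup V] (f : EuclideanSpace ℝ (Fin 3) → V),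
      eLpNorm f 2 volume = (∫⁻ x, ‖f x‖ₑ ^ 2) ^ (1 / 2 : ℝ) := by
    intro V _ f
    rw [eLpNorm_eq_lintegral_rpow_enorm_toReal (by norm_num) (by norm_num)]
    simp
  rw [key]
  have hg : eLpNorm g 2 volume = (∫⁻ x, ‖g x‖ₑ ^ 2) ^ (1 / 2 : ℝ) := by
    rw [eLpNorm_eq_lintegral_rpow_enorm_toReal (by norm_num) (by norm_num)]
    simp
  rw [hg]
  refine (ENNReal.rpow_le_rpow h (by norm_num)).trans ?_
  rw [ENNReal.mul_rpow_of_nonneg _ _ (by norm_num), ← ENNReal.rpow_natCast, ← ENNReal.rpow_mul]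
  simp

/-- A bounded nonnegative function with bounded support which is subharmonic, where positive, off a
closed set of capacity zero vanishes off that set. -/
theorem eq_zero_of_newtonianCapacity_eq_zero {E : Set (EuclideanSpace ℝ (Fin 3))}
    (hE : IsClosed E) (hcap : newtonianCapacity E = 0) {w : EuclideanSpace ℝ (Fin 3) → ℝ}
    (hw : ∀ x ∈ Eᶜ, ContDiffAt ℝ 2 w x)
    (hsub : ∀ x ∈ Eᶜ, 0 ≤ w x * ∑ i, partialDeriv i (partialDeriv i w) x)
    (hw0 : ∀ x, 0 ≤ w x) {M : ℝ} (hM : ∀ x, w x ≤ M) {R : ℝ} (hR : ∀ x, R < ‖x‖ → w x = 0)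
    {y : EuclideanSpace ℝ (Fin 3)} (hy : y ∈ Eᶜ) : w y = 0 := by
  by_contra hne
  have hpos : 0 < w y := lt_of_le_of_ne (hw0 y) (Ne.symm hne)
  have hM0 : 0 ≤ M := (hw0 y).trans (hM y)
  set δ := w y / 2 with hδ
  have hδ0 : 0 < δ := by positivity
  obtain ⟨ρ, hρ, hball⟩ : ∃ ρ > 0, ∀ z ∈ Metric.ball y ρ, δ ≤ w z := by
    have := (hw y hy).continuousAt.eventually (lt_mem_nhds (show δ < w y by linarith))
    obtain ⟨ρ, hρ, h⟩ := Metric.eventually_nhds_iff_ball.1 this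
    exact ⟨ρ, hρ, fun z hz => (h z hz).le⟩
  obtain ⟨L, hL0, hL⟩ := exists_deriv_cutoffProfile_le
  obtain ⟨S, hS⟩ := eLpNorm_six_le_eLpNorm_fderiv_two
  have hwc : HasCompactSupport w := HasCompactSupport.intro
    (isCompact_closedBall (0 : EuclideanSpace ℝ (Fin 3)) R) fun x hx => hR x (by simpa using hx)
  set A : ℝ≥0∞ := eLpNorm ((Metric.ball y ρ).indicator fun _ => δ) 6 volume with hA
  have hA0 : A ≠ 0 := by
    rw [hA, eLpNorm_indicator_const Metric.isOpen_ball.measurableSet (by norm_num) (by norm_num)]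
    refine mul_ne_zero (by simp [hδ0.ne']) ?_
    rw [Ne, ENNReal.rpow_eq_zero_iff]
    have h1 := (Metric.measure_ball_pos volume y hρ).ne'
    rintro (h | h)
    · exact h1 h.1
    · norm_num at h
  set c : ℝ≥0∞ := ENNReal.ofReal (M * L) with hc
  have key : ∀ ε : ℝ≥0∞, ε ≠ 0 → A ≤ 2 * S * c * ε ^ (1 / 2 : ℝ) := by
    intro ε hε
    obtain ⟨φ, hφ, hφc, hφ1, hφe⟩ := exists_energy_lt hcap
      ((isCompact_closedBall (0 : EuclideanSpace ℝ (Fin 3)) (R + 1)).inter_left hE)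
      inter_subset_left hε
    set η : EuclideanSpace ℝ (Fin 3) → ℝ := fun x => cutoffProfile (φ x) with hη
    have hηC : ContDiff ℝ 2 η := contDiff_infty.1 (contDiff_cutoffProfile.comp hφ) 2
    have hηE : ∀ x ∈ tsupport η, x ∉ E ∨ w =ᶠ[𝓝 x] fun _ => 0 := by
      intro x hx
      by_contra! hcon
      obtain ⟨hxE, hxw⟩ := hcon
      by_cases hxR : ‖x‖ ≤ R + 1
      · have h1 : 1 ≤ φ x := hφ1 x ⟨hxE, by simpa using hxR⟩
        have h2 : η =ᶠ[𝓝 x] 0 := by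
          filter_upwards [hφ.continuous.continuousAt.eventually
            (lt_mem_nhds (show 1 / 2 < φ x by linarith))] with z hz
          exact cutoffProfile_of_half_le hz.le
        exact (notMem_tsupport_iff_eventuallyEq.2 h2) hx
      · refine hxw ?_
        filter_upwards [continuous_norm.continuousAt.eventually
          (lt_mem_nhds (show R < ‖x‖ by linarith))] with z hz
        exact hR z hz
    have hwη : ∀ x ∈ tsupport η, ContDiffAt ℝ 2 w x := fun x hx =>
      (hηE x hx).elim (fun h => hw x h) fun h => contDiffAt_const.congr_of_eventuallyEq h
    obtain ⟨hi1, hi2, hle⟩ := integral_norm_fderiv_mul_sq_le hηC hwη hwc fun x hx =>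
      (hηE x hx).elim (fun h => hsub x h) fun h => by simp [h.self_of_nhds]
    have hfC : ContDiff ℝ 1 fun x => η x * w x := contDiff_mul_of_tsupport (n := 1)
      (hηC.of_le (by norm_num)) fun x hx => (hwη x hx).of_le (by norm_num)
    have hfc : HasCompactSupport fun x => η x * w x := hwc.mul_left
    have hdη : ∀ x, ‖fderiv ℝ η x‖ ≤ L * ‖fderiv ℝ φ x‖ := by
      intro x
      have h1 := ((contDiff_cutoffProfile.differentiable (by simp)
        (φ x)).hasDerivAt.comp_hasFDerivAt x (hφ.differentiable (by simp) x).hasFDerivAt).fderiv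
      change ‖fderiv ℝ (cutoffProfile ∘ φ) x‖ ≤ _
      rw [h1, norm_smul]
      exact mul_le_mul_of_nonneg_right (hL _) (norm_nonneg _)
    have hgrad : eLpNorm (fderiv ℝ fun x => η x * w x) 2 volume ≤
        c * eLpNorm (fderiv ℝ φ) 2 volume := by
      refine eLpNorm_two_le_of_lintegral_le ?_
      have e1 : ∫⁻ x, ‖fderiv ℝ (fun x => η x * w x) x‖ₑ ^ 2 =
          ENNReal.ofReal (∫ x, ‖fderiv ℝ (fun x => η x * w x) x‖ ^ 2) := by
        rw [ofReal_integral_eq_lintegral_ofReal hi1 (Eventually.of_forall fun x => by positivity)]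
        refine lintegral_congr fun x => ?_
        rw [ENNReal.ofReal_pow (norm_nonneg _), ofReal_norm]
      rw [e1]
      refine (ENNReal.ofReal_le_ofReal hle).trans ?_
      rw [ofReal_integral_eq_lintegral_ofReal hi2 (Eventually.of_forall fun x => by positivity),
        ← lintegral_const_mul' _ _ (by simp [hc])]
      refine lintegral_mono fun x => ?_
      rw [hc, ← ofReal_norm (fderiv ℝ φ x), ← mul_pow, ← mul_pow, ← ENNReal.ofReal_mul (by positivity),
        ← ENNReal.ofReal_pow (by positivity)]
      refine ENNReal.ofReal_le_ofReal (pow_le_pow_left₀ (mul_nonneg (hw0 x) (norm_nonneg _)) ?_ 2)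
      calc w x * ‖fderiv ℝ η x‖ ≤ M * (L * ‖fderiv ℝ φ x‖) :=
            mul_le_mul (hM x) (hdη x) (norm_nonneg _) hM0
        _ = M * L * ‖fderiv ℝ φ x‖ := by ring
    have hpt : ∀ x, ‖(Metric.ball y ρ).indicator (fun _ => δ) x‖ ≤
        ‖η x * w x‖ + ‖(M * L) * φ x‖ := by
      intro x
      by_cases hx : x ∈ Metric.ball y ρ
      · rw [indicator_of_mem hx, Real.norm_eq_abs, Real.norm_eq_abs, Real.norm_eq_abs,
          abs_of_pos hδ0]
        have h1 := abs_one_sub_cutoffProfile_le hL (φ x)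
        have h2 : |w x| ≤ |η x * w x| + |(1 - η x) * w x| := by
          calc |w x| = |η x * w x + (1 - η x) * w x| := by ring_nf
            _ ≤ _ := abs_add_le _ _
        have h3 : |(1 - η x) * w x| ≤ (L * |φ x|) * M := by
          rw [abs_mul, abs_of_nonneg (hw0 x)]
          exact mul_le_mul h1 (hM x) (hw0 x) (by positivity)
        rw [abs_mul (M * L), abs_of_nonneg (mul_nonneg hM0 hL0)]
        have h4 := hball x hx
        have h5 := le_abs_self (w x)
        linarith
      · rw [indicator_of_notMem hx, norm_zero]
        positivity
    have hAle : A ≤ eLpNorm (fun x => η x * w x) 6 volume +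
        eLpNorm (fun x => (M * L) * φ x) 6 volume := by
      have h1 : A ≤ eLpNorm (fun x => ‖η x * w x‖ + ‖(M * L) * φ x‖) 6 volume := by
        refine eLpNorm_mono_real fun x => (hpt x).trans (le_refl _)
      refine h1.trans ((eLpNorm_add_le (f := fun x => ‖η x * w x‖)
        (g := fun x => ‖(M * L) * φ x‖) hfC.continuous.norm.aestronglyMeasurable
        (continuous_const.mul hφ.continuous).norm.aestronglyMeasurable (by norm_num)).trans ?_)
      rw [eLpNorm_norm, eLpNorm_norm]
    have hcφ : eLpNorm (fun x => (M * L) * φ x) 6 volume ≤ c * eLpNorm φ 6 volume := by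
      refine (eLpNorm_const_smul_le (c := M * L) (f := φ)).trans (le_of_eq ?_)
      rw [hc, ← ofReal_norm, Real.norm_of_nonneg (mul_nonneg hM0 hL0)]
    have hφe' : eLpNorm (fderiv ℝ φ) 2 volume ≤ ε ^ (1 / 2 : ℝ) := by
      rw [eLpNorm_eq_lintegral_rpow_enorm_toReal (by norm_num) (by norm_num)]
      simpa using ENNReal.rpow_le_rpow hφe.le (show (0 : ℝ) ≤ 1 / 2 by norm_num)
    calc A ≤ eLpNorm (fun x => η x * w x) 6 volume + eLpNorm (fun x => (M * L) * φ x) 6 volume :=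
          hAle
      _ ≤ S * (c * eLpNorm (fderiv ℝ φ) 2 volume) + c * (S * eLpNorm (fderiv ℝ φ) 2 volume) := by
          refine add_le_add ((hS _ hfC hfc).trans ?_) (hcφ.trans ?_)
          · gcongr
          · gcongr
            exact hS φ (hφ.of_le (by exact_mod_cast le_top)) hφc
      _ = 2 * S * c * eLpNorm (fderiv ℝ φ) 2 volume := by ring
      _ ≤ _ := by gcongr
  have hlim : Tendsto (fun ε : ℝ≥0∞ => 2 * S * c * ε ^ (1 / 2 : ℝ)) (𝓝[≠] 0) (𝓝 0) := by
    have h1 : Tendsto (fun ε : ℝ≥0∞ => ε ^ (1 / 2 : ℝ)) (𝓝 0) (𝓝 0) := by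
      have := (ENNReal.continuous_rpow_const (y := 1 / 2)).tendsto 0
      simpa using this
    have h2 := ENNReal.Tendsto.const_mul (a := 2 * S * c) (h1.mono_left (nhdsWithin_le_nhds (s := {0}ᶜ)))
      (Or.inr (by finiteness))
    simpa using h2
  have : A ≤ 0 := ge_of_tendsto hlim (by
    filter_upwards [self_mem_nhdsWithin] with ε hε
    exact key ε hε)
  exact hA0 (le_antisymm this zero_le)

/-- A nonnegative harmonic function off a closed set of capacity zero which is at least `m` on a
ball dominates the multiple of the Newtonian kernel with boundary value `m` on that ball. -/
theorem mul_div_norm_le_of_harmonic {E : Set (EuclideanSpace ℝ (Fin 3))} (hE : IsClosed E)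
    (hcap : newtonianCapacity E = 0) {u : EuclideanSpace ℝ (Fin 3) → ℝ}
    (hu : InnerProductSpace.HarmonicOnNhd u Eᶜ) (hu0 : ∀ x ∈ Eᶜ, 0 ≤ u x)
    {a : EuclideanSpace ℝ (Fin 3)} {r m : ℝ} (hr : 0 < r) (hm : 0 ≤ m)
    (hum : ∀ x ∈ Eᶜ, ‖x - a‖ ≤ r → m ≤ u x)
    {y : EuclideanSpace ℝ (Fin 3)} (hy : y ∈ Eᶜ) (hya : r < ‖y - a‖) :
    m * r / ‖y - a‖ ≤ u y := by
  refine le_of_forall_pos_le_add fun s hs => ?_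
  set k : EuclideanSpace ℝ (Fin 3) → ℝ := fun x => m * r * ‖x - a‖⁻¹ with hk
  set v : EuclideanSpace ℝ (Fin 3) → ℝ := fun x => k x - u x with hv
  set F : ℝ → ℝ := fun t => posCube (t - s) with hF
  set D : Set (EuclideanSpace ℝ (Fin 3)) := {x | x ∈ Eᶜ ∧ r < ‖x - a‖} with hD
  set w : EuclideanSpace ℝ (Fin 3) → ℝ := D.indicator fun x => F (v x) with hw
  have hDo : IsOpen D :=
    hE.isOpen_compl.inter (isOpen_lt continuous_const (continuous_id.sub continuous_const).norm)
  have hFC : ContDiff ℝ 2 F := contDiff_posCube.comp (contDiff_id.sub contDiff_const)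
  have hkm : ∀ x, r ≤ ‖x - a‖ → k x ≤ m := by
    intro x hx
    have : r * ‖x - a‖⁻¹ ≤ 1 := by
      rw [← div_eq_mul_inv]
      exact div_le_one_of_le₀ hx (norm_nonneg _)
    calc k x = m * (r * ‖x - a‖⁻¹) := mul_assoc _ _ _
      _ ≤ m * 1 := mul_le_mul_of_nonneg_left this hm
      _ = m := mul_one m
  have hin : ∀ x ∈ D, ContDiffAt ℝ 2 v x ∧ ∑ i, partialDeriv i (partialDeriv i v) x = 0 := by
    intro x hx
    have hne : ∀ z ∈ D, z ≠ a := by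
      rintro z hz rfl
      have := hz.2
      simp at this
      linarith
    have hkC : ∀ z ∈ D, ContDiffAt ℝ 2 k z := fun z hz =>
      contDiffAt_const.mul (contDiffAt_norm_sub_inv (hne z hz))
    refine ⟨(hkC x hx).sub (hu x hx.1).1, ?_⟩
    have h1 : ∀ i, partialDeriv i v =ᶠ[𝓝 x]
        fun z => m * r * partialDeriv i (fun z => ‖z - a‖⁻¹) z - partialDeriv i u z := by
      intro i
      filter_upwards [hDo.mem_nhds hx] with z hz
      rw [hv, partialDeriv_sub ((hkC z hz).differentiableAt (by norm_num))
        ((hu z hz.1).1.differentiableAt (by norm_num)), hk, partialDeriv_const_mul _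
        ((contDiffAt_norm_sub_inv (hne z hz)).differentiableAt (by norm_num))]
    have h2 : ∀ i, partialDeriv i (partialDeriv i v) x =
        m * r * partialDeriv i (partialDeriv i fun z => ‖z - a‖⁻¹) x -
          partialDeriv i (partialDeriv i u) x := by
      intro i
      have hd1 := ((contDiffAt_norm_sub_inv (hne x hx)).partialDeriv_one i).differentiableAt
        (by norm_num)
      have hd2 := ((hu x hx.1).1.partialDeriv_one i).differentiableAt (by norm_num)
      rw [partialDeriv_congr (h1 i), partialDeriv_sub (hd1.const_mul _) hd2,
        partialDeriv_const_mul _ hd1]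
    simp only [h2]
    rw [Finset.sum_sub_distrib, ← Finset.mul_sum, sum_partialDeriv_norm_sub_inv (hne x hx),
      (hu x hx.1).sum_partialDeriv]
    simp
  have hev : ∀ x ∈ D, w =ᶠ[𝓝 x] fun z => F (v z) := fun x hx => by
    filter_upwards [hDo.mem_nhds hx] with z hz
    simp [hw, hz]
  have hout : ∀ x ∈ Eᶜ, x ∉ D → w =ᶠ[𝓝 x] fun _ => 0 := by
    intro x hx hxD
    have hxr : ‖x - a‖ ≤ r := by
      by_contra! h
      exact hxD ⟨hx, h⟩
    have h1 : ∀ᶠ z in 𝓝 x, m - s < u z :=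
      (hu x hx).1.continuousAt.eventually (lt_mem_nhds (by linarith [hum x hx hxr]))
    filter_upwards [h1] with z hz
    by_cases hzD : z ∈ D
    · rw [hw, indicator_of_mem hzD]
      exact posCube_of_nonpos (by
        have := hkm z hzD.2.le
        simp only [hv]
        linarith)
    · rw [hw, indicator_of_notMem hzD]
  have hw0 : ∀ x, 0 ≤ w x := fun x => indicator_nonneg (fun z _ => posCube_nonneg _) x
  have hmain : w y = 0 := by
    refine eq_zero_of_newtonianCapacity_eq_zero hE hcap (w := w) (M := m ^ 3)
      (R := m * r / s + ‖a‖) ?_ ?_ hw0 ?_ ?_ hy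
    · intro x hx
      by_cases hxD : x ∈ D
      · exact (hFC.contDiffAt.comp x (hin x hxD).1).congr_of_eventuallyEq (hev x hxD)
      · exact contDiffAt_const.congr_of_eventuallyEq (hout x hx hxD)
    · intro x hx
      by_cases hxD : x ∈ D
      · have h1 : ∀ i, partialDeriv i (partialDeriv i w) x =
            partialDeriv i (partialDeriv i fun z => F (v z)) x := fun i => by
          refine partialDeriv_congr ?_
          filter_upwards [(hev x hxD).eventually_nhds] with z hz
          exact partialDeriv_congr hz
        simp only [h1]
        rw [sum_partialDeriv_comp hFC (hin x hxD).1, (hin x hxD).2, mul_zero, add_zero]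
        refine mul_nonneg (hw0 x) (mul_nonneg ?_ (Finset.sum_nonneg fun i _ => sq_nonneg _))
        have e1 : deriv F = fun t => deriv posCube (t - s) :=
          funext fun t => deriv_comp_sub_const posCube s t
        have e2 : deriv (deriv F) (v x) = deriv (deriv posCube) (v x - s) := by
          rw [e1]
          exact deriv_comp_sub_const (deriv posCube) s (v x)
        rw [e2, (hasDerivAt_deriv_posCube _).deriv]
        exact mul_nonneg (by norm_num) (le_max_right _ _)
      · rw [(hout x hx hxD).self_of_nhds, zero_mul]
    · intro x
      by_cases hxD : x ∈ D
      · rw [hw, indicator_of_mem hxD]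
        have := hkm x hxD.2.le
        have := hu0 x hxD.1
        exact posCube_le hm (by simp only [hv]; linarith)
      · rw [hw, indicator_of_notMem hxD]
        positivity
    · intro x hx
      by_cases hxD : x ∈ D
      · rw [hw, indicator_of_mem hxD]
        refine posCube_of_nonpos ?_
        have h1 := hu0 x hxD.1
        have h2 : m * r / s < ‖x - a‖ := by linarith [norm_sub_norm_le x a]
        have h3 : 0 < ‖x - a‖ := hr.trans hxD.2
        have h4 : k x ≤ s := by
          rw [hk]
          simp only
          rw [← div_eq_mul_inv, div_le_iff₀ h3]
          rw [div_lt_iff₀ hs] at h2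
          linarith
        simp only [hv]
        linarith
      · rw [hw, indicator_of_notMem hxD]
  rw [hw, indicator_of_mem (show y ∈ D from ⟨hy, hya⟩)] at hmain
  have := nonpos_of_posCube_eq_zero hmain
  simp only [hv, hk] at this
  rw [div_eq_mul_inv]
  linarith

/-- The radial kernel `(1 - |z|²)⁺`. -/
noncomputable def ballKernel (z : EuclideanSpace ℝ (Fin 3)) : ℝ := max (1 - ‖z‖ ^ 2) 0

lemma ballKernel_nonneg (z : EuclideanSpace ℝ (Fin 3)) : 0 ≤ ballKernel z := le_max_right _ _

lemma ballKernel_of_one_le {z : EuclideanSpace ℝ (Fin 3)} (h : 1 ≤ ‖z‖) : ballKernel z = 0 :=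
  max_eq_right (by nlinarith)

lemma ballKernel_le_one (z : EuclideanSpace ℝ (Fin 3)) : ballKernel z ≤ 1 :=
  max_le (by nlinarith [norm_nonneg z]) zero_le_one

lemma continuous_ballKernel : Continuous ballKernel :=
  (continuous_const.sub (continuous_norm.pow 2)).max continuous_const

lemma hasCompactSupport_ballKernel : HasCompactSupport ballKernel :=
  HasCompactSupport.intro (isCompact_closedBall (0 : EuclideanSpace ℝ (Fin 3)) 1) fun z hz =>
    ballKernel_of_one_le (by simpa using (le_of_lt (by simpa using hz : 1 < ‖z‖)))

lemma integral_ballKernel_pos : 0 < ∫ z, ballKernel z := by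
  refine continuous_ballKernel.integral_pos_of_hasCompactSupport_nonneg_nonzero
    hasCompactSupport_ballKernel ballKernel_nonneg (x := 0) ?_
  simp [ballKernel]

lemma contDiff_ballKernel_sq : ContDiff ℝ 1 fun z => ballKernel z ^ 2 := by
  have h : ContDiff ℝ 1 fun t : ℝ => max t 0 ^ 2 := by
    rw [contDiff_one_iff_deriv]
    refine ⟨fun t => (hasDerivAt_max_zero_pow 0 t).differentiableAt, ?_⟩
    have : deriv (fun t : ℝ => max t 0 ^ 2) = fun t => 2 * max t 0 := by
      funext t
      simpa using (hasDerivAt_max_zero_pow 0 t).deriv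
    rw [this]
    fun_prop
  exact h.comp (contDiff_const.sub (contDiff_norm_sq ℝ))

lemma partialDeriv_ballKernel_sq (i : Fin 3) (z : EuclideanSpace ℝ (Fin 3)) :
    partialDeriv i (fun z => ballKernel z ^ 2) z = -4 * (ballKernel z * z i) := by
  have h1 : HasFDerivAt (fun y : EuclideanSpace ℝ (Fin 3) => 1 - ‖y‖ ^ 2)
      (-(2 • innerSL ℝ z)) z := by
    simpa using (hasFDerivAt_id z).norm_sq.const_sub 1
  have h2 := ((hasDerivAt_max_zero_pow 0 (1 - ‖z‖ ^ 2)).comp_hasFDerivAt z h1).fderiv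
  change fderiv ℝ ((fun t : ℝ => max t 0 ^ (0 + 2)) ∘ fun y => 1 - ‖y‖ ^ 2) z _ = _
  rw [h2]
  simp [EuclideanSpace.inner_single_right, ballKernel]
  ring

lemma integral_ballKernel_mul_fderiv_eq_zero {u : EuclideanSpace ℝ (Fin 3) → ℝ}
    (hu : ContDiff ℝ 2 u) {a : EuclideanSpace ℝ (Fin 3)} {t T : ℝ} (ht0 : 0 ≤ t) (htT : t ≤ T)
    (hΔ : ∀ x, ‖x - a‖ ≤ T → ∑ i, partialDeriv i (partialDeriv i u) x = 0) :
    ∫ z, ballKernel z * fderiv ℝ u (a + t • z) z = 0 := by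
  have hui : ∀ i, ContDiff ℝ 1 (partialDeriv i u) := fun i =>
    (hu.fderiv_right (m := 1) (by norm_num)).clm_apply contDiff_const
  have haff : ContDiff ℝ 1 fun z : EuclideanSpace ℝ (Fin 3) => a + t • z :=
    contDiff_const.add (contDiff_id.const_smul t)
  set g : Fin 3 → EuclideanSpace ℝ (Fin 3) → ℝ := fun i z =>
    ballKernel z ^ 2 * partialDeriv i u (a + t • z) with hg
  have hgC : ∀ i, ContDiff ℝ 1 (g i) := fun i => contDiff_ballKernel_sq.mul ((hui i).comp haff)
  have hgc : ∀ i, HasCompactSupport (g i) := fun i =>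
    (hasCompactSupport_ballKernel.comp_left (g := fun t : ℝ => t ^ 2) (by simp)).mul_right
  have hgi : ∀ i, Integrable (partialDeriv i (g i)) := fun i =>
    (((hgC i).continuous_fderiv (by norm_num)).clm_apply
      continuous_const).integrable_of_hasCompactSupport
        ((hgc i).fderiv_apply ℝ (EuclideanSpace.single i 1))
  have hchain : ∀ i z, partialDeriv i (fun z => partialDeriv i u (a + t • z)) z =
      t * partialDeriv i (partialDeriv i u) (a + t • z) := by
    intro i z
    have h1 : HasFDerivAt (fun z : EuclideanSpace ℝ (Fin 3) => a + t • z)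
        (t • ContinuousLinearMap.id ℝ (EuclideanSpace ℝ (Fin 3))) z :=
      ((hasFDerivAt_id z).const_smul t).const_add a
    have h2 := (((hui i).differentiable (by norm_num) (a + t • z)).hasFDerivAt.comp z h1).fderiv
    change fderiv ℝ (partialDeriv i u ∘ fun z => a + t • z) z _ = _
    rw [h2]
    simp [partialDeriv]
  have hexp : ∀ x z : EuclideanSpace ℝ (Fin 3),
      fderiv ℝ u x z = ∑ i, z i * partialDeriv i u x := by
    intro x z
    have h1 : z = ∑ i, z i • EuclideanSpace.single i (1 : ℝ) := by
      ext j
      simp [Finset.sum_apply, Pi.single_apply]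
    conv_lhs => rw [h1]
    simp [partialDeriv]
  have hpt : ∀ z, ballKernel z * fderiv ℝ u (a + t • z) z =
      -(1 / 4) * ∑ i, partialDeriv i (g i) z := by
    intro z
    have h1 : ∀ i, partialDeriv i (g i) z =
        t * ballKernel z ^ 2 * partialDeriv i (partialDeriv i u) (a + t • z) +
          (-4 * ballKernel z) * (z i * partialDeriv i u (a + t • z)) := by
      intro i
      change partialDeriv i (fun z => ballKernel z ^ 2 * partialDeriv i u (a + t • z)) z = _
      rw [partialDeriv_mul (g := fun z => partialDeriv i u (a + t • z))
        (contDiff_ballKernel_sq.differentiable (by norm_num) z)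
        (((hui i).comp haff).differentiable (by norm_num) z), hchain, partialDeriv_ballKernel_sq]
      ring
    simp only [h1]
    rw [Finset.sum_add_distrib, ← Finset.mul_sum, ← Finset.mul_sum, ← hexp]
    have h2 : t * ballKernel z ^ 2 * ∑ i, partialDeriv i (partialDeriv i u) (a + t • z) = 0 := by
      rcases le_or_gt 1 ‖z‖ with hz | hz
      · rw [ballKernel_of_one_le hz]
        simp
      · rw [hΔ, mul_zero]
        rw [add_sub_cancel_left, norm_smul, Real.norm_of_nonneg ht0]
        nlinarith
    rw [h2]
    ring
  simp only [hpt]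
  rw [integral_const_mul, integral_finsetSum _ fun i _ => hgi i]
  simp [integral_partialDeriv_eq_zero _ (hgC _) (hgc _)]

/-- The mean value property of harmonic functions, with respect to the kernel `(1 - |z|²)⁺`. -/
lemma integral_ballKernel_mul_eq {u : EuclideanSpace ℝ (Fin 3) → ℝ}
    (hu : ContDiff ℝ 2 u) (huc : HasCompactSupport u) {a : EuclideanSpace ℝ (Fin 3)} {T : ℝ}
    (hT : 0 ≤ T) (hΔ : ∀ x, ‖x - a‖ ≤ T → ∑ i, partialDeriv i (partialDeriv i u) x = 0) :
    ∫ z, ballKernel z * u (a + T • z) = u a * ∫ z, ballKernel z := by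
  have hdc : Continuous (fderiv ℝ u) := hu.continuous_fderiv (by norm_num)
  obtain ⟨C, hC⟩ := (huc.fderiv ℝ).exists_bound_of_continuous hdc
  have hderiv : ∀ t : ℝ, HasDerivAt (fun t : ℝ => ∫ z, ballKernel z * u (a + t • z))
      (∫ z, ballKernel z * fderiv ℝ u (a + t • z) z) t := by
    intro t
    have hFc : ∀ s : ℝ, Continuous fun z => ballKernel z * u (a + s • z) := fun s =>
      continuous_ballKernel.mul (hu.continuous.comp (continuous_const.add (continuous_const_smul s)))
    refine (hasDerivAt_integral_of_dominated_loc_of_deriv_le (μ := volume) (s := univ)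
      (F' := fun s z => ballKernel z * fderiv ℝ u (a + s • z) z)
      (bound := fun z => ballKernel z * C) univ_mem
      (Eventually.of_forall fun s => (hFc s).aestronglyMeasurable)
      ((hFc t).integrable_of_hasCompactSupport hasCompactSupport_ballKernel.mul_right)
      ?_ ?_ ?_ ?_).2
    · exact (continuous_ballKernel.mul ((hdc.comp (continuous_const.add
        (continuous_const_smul t))).clm_apply continuous_id)).aestronglyMeasurable
    · refine Eventually.of_forall fun z s _ => ?_
      rw [norm_mul, Real.norm_of_nonneg (ballKernel_nonneg z)]
      rcases le_or_gt 1 ‖z‖ with hz | hz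
      · simp [ballKernel_of_one_le hz]
      · refine mul_le_mul_of_nonneg_left ?_ (ballKernel_nonneg z)
        calc ‖fderiv ℝ u (a + s • z) z‖ ≤ ‖fderiv ℝ u (a + s • z)‖ * ‖z‖ :=
              ContinuousLinearMap.le_opNorm _ _
          _ ≤ ‖fderiv ℝ u (a + s • z)‖ * 1 := by gcongr
          _ ≤ C := by rw [mul_one]; exact hC _
    · exact (continuous_ballKernel.mul continuous_const).integrable_of_hasCompactSupport
        hasCompactSupport_ballKernel.mul_right
    · refine Eventually.of_forall fun z s _ => ?_
      have h1 : HasDerivAt (fun s : ℝ => a + s • z) z s := by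
        simpa using ((hasDerivAt_id s).smul_const z).const_add a
      exact ((hu.differentiable (by norm_num)
        (a + s • z)).hasFDerivAt.comp_hasDerivAt s h1).const_mul _
  have hconst := constant_of_derivWithin_zero
    (f := fun t : ℝ => ∫ z, ballKernel z * u (a + t • z)) (a := 0) (b := T)
    (fun t _ => (hderiv t).differentiableAt.differentiableWithinAt) (fun t ht => by
      rw [((hderiv t).hasDerivWithinAt).derivWithin
        (uniqueDiffOn_Icc (lt_of_le_of_lt ht.1 ht.2) t (Ico_subset_Icc_self ht))]
      exact integral_ballKernel_mul_fderiv_eq_zero hu ht.1 ht.2.le hΔ) T (right_mem_Icc.2 hT)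
  rw [hconst]
  simp only [zero_smul, add_zero]
  rw [integral_mul_const, mul_comm]

lemma integral_ballKernel_mul_comp (u : EuclideanSpace ℝ (Fin 3) → ℝ)
    (a : EuclideanSpace ℝ (Fin 3)) {T : ℝ} (hT : 0 < T) :
    ∫ z, ballKernel z * u (a + T • z) =
      (T ^ 3)⁻¹ * ∫ x, ballKernel (T⁻¹ • (x - a)) * u x := by
  have h1 : ∀ z, ballKernel z * u (a + T • z) =
      (fun x => ballKernel (T⁻¹ • x) * u (a + x)) (T • z) := by
    intro z
    simp only
    rw [smul_smul, inv_mul_cancel₀ hT.ne', one_smul]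
  rw [integral_congr_ae (Eventually.of_forall h1),
    Measure.integral_comp_smul volume fun x => ballKernel (T⁻¹ • x) * u (a + x)]
  have h2 := integral_add_left_eq_self (μ := volume)
    (fun x => ballKernel (T⁻¹ • (x - a)) * u x) a
  rw [← h2]
  simp [abs_of_pos hT]

/-- **Harnack's inequality** for nonnegative harmonic functions in `ℝ³`. -/
theorem harnack_of_harmonic {U : Set (EuclideanSpace ℝ (Fin 3))}
    {u : EuclideanSpace ℝ (Fin 3) → ℝ}
    (hu : InnerProductSpace.HarmonicOnNhd u U) (hu0 : ∀ x ∈ U, 0 ≤ u x)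
    {x y : EuclideanSpace ℝ (Fin 3)} {r : ℝ} (hr : 0 < r)
    (hxU : Metric.closedBall x (6 * r) ⊆ U) (hxy : ‖y - x‖ ≤ r) : u x ≤ 100 * u y := by
  let χ : ContDiffBump x := ⟨11 / 2 * r, 6 * r, by positivity, by linarith⟩
  set v : EuclideanSpace ℝ (Fin 3) → ℝ := fun z => χ z * u z with hv
  have hts : tsupport χ = Metric.closedBall x (6 * r) := χ.tsupport_eq
  have hvC : ContDiff ℝ 2 v := contDiff_mul_of_tsupport (n := 2) χ.contDiff fun z hz =>
    (hu z (hxU (hts ▸ hz))).1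
  have hvc : HasCompactSupport v := χ.hasCompactSupport.mul_right
  have hv0 : ∀ z, 0 ≤ v z := by
    intro z
    by_cases hz : z ∈ Metric.closedBall x (6 * r)
    · exact mul_nonneg χ.nonneg (hu0 z (hxU hz))
    · rw [hv]
      have : χ z = 0 := image_eq_zero_of_notMem_tsupport (by rwa [hts])
      simp [this]
  have hveq : ∀ z, ‖z - x‖ ≤ 11 / 2 * r → v z = u z := by
    intro z hz
    have : χ z = 1 := χ.one_of_mem_closedBall (by simpa [dist_eq_norm] using hz)
    simp [hv, this]
  have hΔ : ∀ z, ‖z - x‖ ≤ 5 * r → ∑ i, partialDeriv i (partialDeriv i v) z = 0 := by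
    intro z hz
    have hev : v =ᶠ[𝓝 z] u := by
      have : ∀ᶠ ζ in 𝓝 z, ‖ζ - x‖ < 11 / 2 * r :=
        (continuous_id.sub continuous_const).norm.continuousAt.eventually
          (gt_mem_nhds (show ‖z - x‖ < 11 / 2 * r by linarith))
      filter_upwards [this] with ζ hζ
      exact hveq ζ hζ.le
    have h1 : ∀ i, partialDeriv i (partialDeriv i v) z = partialDeriv i (partialDeriv i u) z :=
      fun i => by
        refine partialDeriv_congr ?_
        filter_upwards [hev.eventually_nhds] with ζ hζ
        exact partialDeriv_congr hζ
    simp only [h1]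
    exact (hu z (hxU (by rw [mem_closedBall_iff_norm]; linarith))).sum_partialDeriv
  have hr4 : 0 < 4 * r := by positivity
  have hx := integral_ballKernel_mul_eq hvC hvc hr.le fun z hz => hΔ z (by linarith)
  have hy := integral_ballKernel_mul_eq hvC hvc hr4.le fun z (hz : ‖z - y‖ ≤ 4 * r) =>
    hΔ z (by linarith [norm_sub_le_norm_sub_add_norm_sub z y x])
  rw [integral_ballKernel_mul_comp v _ hr, hveq x (by simp; positivity)] at hx
  rw [integral_ballKernel_mul_comp v _ hr4, hveq y (by linarith)] at hy
  have hint : ∀ (b : EuclideanSpace ℝ (Fin 3)) (s : ℝ),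
      Integrable fun z => ballKernel (s • (z - b)) * v z := fun b s =>
    ((continuous_ballKernel.comp ((continuous_id.sub continuous_const).const_smul s)).mul
      hvC.continuous).integrable_of_hasCompactSupport hvc.mul_left
  have hmono : ∫ z, ballKernel (r⁻¹ • (z - x)) * v z ≤
      4 / 3 * ∫ z, ballKernel ((4 * r)⁻¹ • (z - y)) * v z := by
    rw [← integral_const_mul]
    refine integral_mono (hint x _) ((hint y _).const_mul _) fun z => ?_
    rw [← mul_assoc (4 / 3 : ℝ) _ (v z)]
    refine mul_le_mul_of_nonneg_right ?_ (hv0 z)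
    rcases le_or_gt r ‖z - x‖ with hz | hz
    · rw [ballKernel_of_one_le]
      · exact mul_nonneg (by norm_num) (ballKernel_nonneg _)
      · rw [norm_smul, norm_inv, Real.norm_of_nonneg hr.le, ← div_eq_inv_mul, le_div_iff₀ hr]
        linarith
    · have h1 : ‖z - y‖ ≤ 2 * r := by
        have := norm_sub_le_norm_sub_add_norm_sub z x y
        rw [norm_sub_rev x y] at this
        linarith
      have h2 : ‖(4 * r)⁻¹ • (z - y)‖ ≤ 1 / 2 := by
        rw [norm_smul, norm_inv, Real.norm_of_nonneg hr4.le, ← div_eq_inv_mul, div_le_iff₀ hr4]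
        linarith
      have h3 : 3 / 4 ≤ ballKernel ((4 * r)⁻¹ • (z - y)) :=
        le_max_of_le_left (by nlinarith [norm_nonneg ((4 * r)⁻¹ • (z - y))])
      linarith [ballKernel_le_one (r⁻¹ • (z - x))]
  have hI := integral_ballKernel_pos
  have hr3 : 0 < r ^ 3 := by positivity
  rw [inv_mul_eq_iff_eq_mul₀ hr3.ne'] at hx
  rw [inv_mul_eq_iff_eq_mul₀ (by positivity)] at hy
  rw [hx, hy] at hmono
  have h4 : r ^ 3 * (∫ z, ballKernel z) * u x ≤
      r ^ 3 * (∫ z, ballKernel z) * (256 / 3 * u y) := by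
    calc _ = r ^ 3 * (u x * ∫ z, ballKernel z) := by ring
      _ ≤ _ := hmono
      _ = _ := by ring
  have h5 := le_of_mul_le_mul_left h4 (by positivity)
  have h6 : 0 ≤ u y := hu0 y (hxU (by rw [mem_closedBall_iff_norm]; linarith))
  linarith

lemma exists_toSphere_eq : ∃ (T : EuclideanSpace ℝ (Fin 3) →ₗᵢ[ℝ] EuclideanSpace ℝ (Fin 4))
    (v : EuclideanSpace ℝ (Fin 4)), ‖v‖ = 1 ∧ (∀ x, inner ℝ (T x) v = 0) ∧
      ∀ x, toSphere x = (‖x‖ ^ 2 + 4)⁻¹ • ((4 : ℝ) • T x + (‖x‖ ^ 2 - 4) • v) := by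
  let B := OrthonormalBasis.fromOrthogonalSpanSingleton (𝕜 := ℝ) 3
    (ne_zero_of_mem_unit_sphere northPole)
  refine ⟨(Submodule.subtypeₗᵢ _).comp B.repr.symm.toLinearIsometry, northPole,
    norm_eq_of_mem_sphere northPole, fun x => ?_, fun x => ?_⟩
  · exact Submodule.mem_orthogonal_singleton_iff_inner_left.1 (B.repr.symm x).2
  · rw [toSphere, stereographic'_symm_apply]
    have hn : ‖((B.repr.symm x : (ℝ ∙ (northPole : EuclideanSpace ℝ (Fin 4)))ᗮ) :
        EuclideanSpace ℝ (Fin 4))‖ = ‖x‖ := B.repr.symm.norm_map x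
    rw [← hn, smul_add]
    rfl

lemma inner_toSphere (x y : EuclideanSpace ℝ (Fin 3)) :
    inner ℝ (toSphere x) (toSphere y) =
      1 - 8 * ‖x - y‖ ^ 2 / ((‖x‖ ^ 2 + 4) * (‖y‖ ^ 2 + 4)) := by
  obtain ⟨T, v, hv, hT, h⟩ := exists_toSphere_eq
  have hT' : ∀ x, inner ℝ v (T x) = 0 := fun x => by rw [real_inner_comm, hT]
  have hvv : inner ℝ v v = (1 : ℝ) := by rw [real_inner_self_eq_norm_sq, hv, one_pow]
  rw [h, h]
  simp only [inner_smul_left, inner_smul_right, inner_add_left, inner_add_right, hT, hT', hvv,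
    LinearIsometry.inner_map_map]
  rw [norm_sub_sq_real]
  simp only [RCLike.conj_to_real]
  have hx : ‖x‖ ^ 2 + 4 ≠ 0 := by positivity
  have hy : ‖y‖ ^ 2 + 4 ≠ 0 := by positivity
  field_simp
  ring

lemma norm_toSphere (x : EuclideanSpace ℝ (Fin 3)) : ‖toSphere x‖ = 1 :=
  norm_eq_of_mem_sphere ((stereographic' 3 northPole).symm x)

lemma sphereDist_mul_sqrt_le (x y : EuclideanSpace ℝ (Fin 3)) :
    sphereDist x y * √(‖x‖ ^ 2 + 4) ≤ Real.pi * ‖x - y‖ := by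
  have h0 : 0 ≤ sphereDist x y := InnerProductGeometry.angle_nonneg _ _
  have hpi : sphereDist x y ≤ Real.pi := InnerProductGeometry.angle_le_pi _ _
  have hcos : Real.cos (sphereDist x y) = inner ℝ (toSphere x) (toSphere y) := by
    rw [sphereDist, InnerProductGeometry.cos_angle, norm_toSphere, norm_toSphere]
    simp
  have h1 := Real.cos_le_one_sub_mul_cos_sq (x := sphereDist x y) (by rwa [abs_of_nonneg h0])
  rw [hcos, inner_toSphere] at h1
  have hx : 0 < ‖x‖ ^ 2 + 4 := by positivity
  have hy : 0 < ‖y‖ ^ 2 + 4 := by positivity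
  have h2 : 2 / Real.pi ^ 2 * sphereDist x y ^ 2 ≤
      8 * ‖x - y‖ ^ 2 / ((‖x‖ ^ 2 + 4) * (‖y‖ ^ 2 + 4)) := by linarith
  have h3 : 8 * ‖x - y‖ ^ 2 / ((‖x‖ ^ 2 + 4) * (‖y‖ ^ 2 + 4)) ≤
      8 * ‖x - y‖ ^ 2 / ((‖x‖ ^ 2 + 4) * 4) := by
    gcongr
    nlinarith [norm_nonneg y]
  have h4 := h2.trans h3
  rw [le_div_iff₀ (by positivity), div_mul_eq_mul_div, div_mul_eq_mul_div,
    div_le_iff₀ (by positivity)] at h4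
  refine le_of_sq_le_sq ?_ (by positivity)
  rw [mul_pow, Real.sq_sqrt hx.le, mul_pow]
  linarith

theorem mainTheorem10 (E : Set (EuclideanSpace ℝ (Fin 3))) (hE : IsClosed E)
    (hcap : newtonianCapacity E = 0) (Ψ : EuclideanSpace ℝ (Fin 3) → ℝ)
    (hharm : InnerProductSpace.HarmonicOnNhd Ψ Eᶜ) (hnonneg : ∀ x ∈ Eᶜ, 0 ≤ Ψ x) :
    ∃ K : ℝ≥0, ∀ x ∈ Eᶜ, ENNReal.ofReal (Ψ x) ≤ (K : ℝ≥0∞) + (K : ℝ≥0∞) / sphereInfDist x E := by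
  rcases Eᶜ.eq_empty_or_nonempty with hemp | ⟨y₀, hy₀⟩
  · exact ⟨0, fun x hx => by simp [hemp] at hx⟩
  have hΨ₀ := hnonneg y₀ hy₀
  set A : ℝ := 1000 * Real.pi * Ψ y₀ * (‖y₀‖ + 1) with hA
  have hA0 : 0 ≤ A := by positivity
  set K : ℝ := 100 * Ψ y₀ + A + 1 with hK
  have hK0 : 0 < K := by positivity
  refine ⟨K.toNNReal, fun x hx => ?_⟩
  change _ ≤ ENNReal.ofReal K + ENNReal.ofReal K / _
  have hnear : ∀ r : ℝ, 0 < r → Metric.closedBall x (6 * r) ⊆ Eᶜ → ‖y₀ - x‖ ≤ r →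
      ENNReal.ofReal (Ψ x) ≤ ENNReal.ofReal K + ENNReal.ofReal K / sphereInfDist x E := by
    intro r hr hsub hle
    have := harnack_of_harmonic hharm hnonneg hr hsub hle
    exact le_add_right (ENNReal.ofReal_le_ofReal (by linarith))
  rcases E.eq_empty_or_nonempty with hEe | hEne
  · exact hnear (‖y₀ - x‖ + 1) (by positivity) (by simp [hEe]) (by linarith)
  obtain ⟨y, hyE, hd⟩ := hE.exists_infDist_eq_dist hEne x
  have hdpos : 0 < ‖x - y‖ := by
    rw [norm_pos_iff, sub_ne_zero]
    rintro rfl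
    exact hx hyE
  rw [dist_eq_norm] at hd
  set r : ℝ := ‖x - y‖ / 10 with hr
  have hr0 : 0 < r := by positivity
  have hball : Metric.closedBall x (6 * r) ⊆ Eᶜ := by
    intro z hz hzE
    have h1 := Metric.infDist_le_dist_of_mem (x := x) hzE
    rw [hd] at h1
    rw [Metric.mem_closedBall, dist_comm] at hz
    linarith
  rcases le_or_gt ‖y₀ - x‖ r with hle | hlt
  · exact hnear r hr0 hball hle
  have hcmp := mul_div_norm_le_of_harmonic hE hcap hharm hnonneg (a := x) (m := Ψ x / 100) hr0
    (by have := hnonneg x hx; positivity)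
    (fun z _ hzr => by linarith [harnack_of_harmonic hharm hnonneg hr0 hball hzr]) hy₀ hlt
  rw [div_le_iff₀ (hr0.trans hlt)] at hcmp
  set q : ℝ := √(‖x‖ ^ 2 + 4) with hq
  have hq1 : 1 ≤ q := Real.one_le_sqrt.2 (by nlinarith [norm_nonneg x])
  have hqx : ‖x‖ ≤ q := Real.le_sqrt_of_sq_le (by linarith)
  have hnorm : ‖y₀ - x‖ ≤ (‖y₀‖ + 1) * q := by
    nlinarith [norm_sub_le y₀ x, norm_nonneg y₀]
  have hθ := sphereDist_mul_sqrt_le x y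
  have hΨx := hnonneg x hx
  have hreal : Ψ x * sphereDist x y ≤ K := by
    have h1 : (Ψ x * sphereDist x y) * q ≤ A * q := by
      calc (Ψ x * sphereDist x y) * q = Ψ x * (sphereDist x y * q) := by ring
        _ ≤ Ψ x * (Real.pi * ‖x - y‖) := mul_le_mul_of_nonneg_left hθ hΨx
        _ = 1000 * Real.pi * (Ψ x / 100 * r) := by rw [hr]; ring
        _ ≤ 1000 * Real.pi * (Ψ y₀ * ‖y₀ - x‖) := by gcongr
        _ ≤ 1000 * Real.pi * (Ψ y₀ * ((‖y₀‖ + 1) * q)) := by gcongr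
        _ = A * q := by rw [hA]; ring
    linarith [le_of_mul_le_mul_right h1 (by linarith)]
  refine le_add_left ?_
  rw [ENNReal.le_div_iff_mul_le (Or.inr (ENNReal.ofReal_pos.2 hK0).ne')
    (Or.inr ENNReal.ofReal_ne_top)]
  calc ENNReal.ofReal (Ψ x) * sphereInfDist x E
      ≤ ENNReal.ofReal (Ψ x) * ENNReal.ofReal (sphereDist x y) := by
        gcongr
        exact iInf₂_le y hyE
    _ = ENNReal.ofReal (Ψ x * sphereDist x y) := (ENNReal.ofReal_mul hΨx).symm
    _ ≤ ENNReal.ofReal K := ENNReal.ofReal_le_ofReal hreal
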